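/- Theorem 1.7. Call a nonzero polynomial hyperbolic if its coefficients are real and all its complex roots are real. The mesh of a hyperbolic polynomial $p$ is the minimal distance between its roots, counted with multiplicity: if $p=C(x-x_1)\cdots(x-x_m)$ with $C\ne0$, $m\ge2$ and $x_1\le\dots\le x_m$, then $\operatorname{mesh}p=\min_{1\le j\le m-1}(x_{j+1}-x_j)$ (in particular $\operatorname{mesh}p=0$ if $p$ has a multiple root), and $\operatorname{mesh}p=+\infty$ if $\deg p\le1$. For real $\theta$ and $h$ put $$\Delta_{\theta,h}(p)(x)=\frac{e^{i\theta}p(x+ih)-e^{-i\theta}p(x-ih)}{2i}.$$ Let $h>0$, and let either $\theta\in(0,\pi)$ and $n\ge2$, or $\theta=0$ and $n\ge3$. Then for every hyperbolic polynomial $p$ of degree $n$ the polynomial $\Delta_{\theta,h}(p)$ is hyperbolic, and $$\operatorname{mesh}\Delta_{\theta,h}(p)\ \ge\ \max\{\operatorname{mesh}p,\ \operatorname{mesh}\Delta_{\theta,h}(x^n)\}\ \ge\ \operatorname{mesh}\Delta_{\theta,h}(x^n).$$ Consequently $\Delta_{\theta,h}$ does not decrease the mesh, and $\operatorname{mesh}\Delta_{\theta,h}(x^n)$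 is the least element of the set of all $\operatorname{mesh}\Delta_{\theta,h}(p)$, $p$ hyperbolic of degree $n$. -/

import Mathlib

open Polynomial
open scoped ENNReal

/-- A complex polynomial is hyperbolic if its coefficients are real and all its complex roots are
real. (The zero polynomial, which vanishes everywhere, is not hyperbolic.) -/
def IsHyperbolic (p : ℂ[X]) : Prop :=
  (∀ k : ℕ, (p.coeff k).im = 0) ∧ ∀ z : ℂ, p.eval z = 0 → z.im = 0

/-- The mesh of a polynomial: the minimal distance between two of its roots, the roots being listed
with multiplicity. The pair `{z, w}` is a sub-multiset of the multiset of complex roots, so `z = w`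
occurs exactly when `z` is a multiple root, and then the mesh is `0`. A polynomial of degree at
most `1` has no such pair, and its mesh is `∞`. -/
noncomputable def mesh (p : ℂ[X]) : ℝ≥0∞ :=
  ⨅ (z : ℂ) (w : ℂ) (_ : ({z, w} : Multiset ℂ) ≤ p.roots), edist z w

/-- The central difference operator
`p(x) ↦ (e^{iθ} p(x + ih) - e^{-iθ} p(x - ih)) / (2i)`. -/
noncomputable def centralDiff (θ h : ℝ) (p : ℂ[X]) : ℂ[X] :=
  C (1 / (2 * Complex.I)) *
    (C (Complex.exp (Complex.I * θ)) * p.comp (X + C (Complex.I * h)) -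
      C (Complex.exp (-(Complex.I * θ))) * p.comp (X - C (Complex.I * h)))

/-! For a > 0 and p with simple real roots, p(x-a)/p(x) = 1 + ∑ B_i/(x-x_i), with B_i =
p(x_i-a)/p'(x_i). If roots are at least a apart, all B_i ≤ 0, so the ratio never enters the open
lower half-plane when Im x > 0: this is `ShiftStable`. Conversely, shift stability for every a up to
m forces mesh at least m (`le_mesh_of_shiftStable`).

Shift stability says that p(x-a) - c p(x) is upper stable whenever Im c < 0. The operator is linear,
commutes with translations and preserves upper stability of nonconstant polynomials, so the bound by
mesh p follows. For the bound by the mesh for x^n, the Grace–Walsh–Szegő theorem transfers shift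
stability from the image of x^n to that of p. -/

/-- `p` has no zeros in the open upper half-plane. -/
def UpperStable (p : ℂ[X]) : Prop := ∀ x : ℂ, 0 < x.im → p.eval x ≠ 0

/-- On the open upper half-plane `p (x - a) / p x` takes no value in the open lower half-plane. -/
def ShiftStable (a : ℝ) (p : ℂ[X]) : Prop :=
  ∀ c : ℂ, c.im < 0 → ∀ x : ℂ, 0 < x.im → p.eval (x - a) - c * p.eval x ≠ 0

/-! ### Central differences and upper stability -/

theorem eval_centralDiff (θ h : ℝ) (p : ℂ[X]) (x : ℂ) :
    (centralDiff θ h p).eval x = 1 / (2 * Complex.I) *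
      (Complex.exp (Complex.I * θ) * p.eval (x + Complex.I * h) -
        Complex.exp (-(Complex.I * θ)) * p.eval (x - Complex.I * h)) := by
  simp [centralDiff]

theorem norm_exp_I_mul (θ : ℝ) : ‖Complex.exp (Complex.I * θ)‖ = 1 := by
  rw [mul_comm]; exact Complex.norm_exp_ofReal_mul_I θ

theorem norm_exp_neg_I_mul (θ : ℝ) : ‖Complex.exp (-(Complex.I * θ))‖ = 1 := by
  have := norm_exp_I_mul (-θ)
  simpa using this

theorem eval_centralDiff_eq_zero {θ h : ℝ} {p : ℂ[X]} {x : ℂ}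
    (hx : (centralDiff θ h p).eval x = 0) :
    Complex.exp (Complex.I * θ) * p.eval (x + Complex.I * h) =
      Complex.exp (-(Complex.I * θ)) * p.eval (x - Complex.I * h) := by
  rw [eval_centralDiff] at hx
  have : (1 / (2 * Complex.I) : ℂ) ≠ 0 := by simp
  exact sub_eq_zero.1 ((mul_eq_zero.1 hx).resolve_left this)

theorem norm_sub_lt_norm_add {h : ℝ} (hh : 0 < h) {w : ℂ} (hw : 0 < w.im) :
    ‖w - Complex.I * h‖ < ‖w + Complex.I * h‖ := by
  rw [← sq_lt_sq₀ (norm_nonneg _) (norm_nonneg _), Complex.sq_norm, Complex.sq_norm,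
    Complex.normSq_apply, Complex.normSq_apply]
  simp
  nlinarith [mul_pos hh hw]

theorem multiset_prod_norm_lt {s : Multiset ℂ} (hs : s ≠ 0) {f g : ℂ → ℂ}
    (h : ∀ z ∈ s, ‖f z‖ < ‖g z‖) : ‖(s.map f).prod‖ < ‖(s.map g).prod‖ := by
  induction s using Multiset.induction with
  | empty => exact absurd rfl hs
  | cons a s ih =>
    have ha := h a (by simp)
    have hs' : ∀ z ∈ s, ‖f z‖ < ‖g z‖ := fun z hz => h z (by simp [hz])
    simp only [Multiset.map_cons, Multiset.prod_cons, norm_mul]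
    by_cases h0 : s = 0
    · simpa [h0] using ha
    · exact mul_lt_mul'' ha (ih h0 hs') (norm_nonneg _) (norm_nonneg _)

theorem UpperStable.ne_zero {p : ℂ[X]} (hp : UpperStable p) : p ≠ 0 := by
  rintro rfl
  exact hp Complex.I (by simp) (by simp)

theorem UpperStable.im_le_zero {p : ℂ[X]} (hp : UpperStable p) {z : ℂ} (hz : z ∈ p.roots) :
    z.im ≤ 0 := by
  by_contra! h
  exact hp z h (isRoot_of_mem_roots hz)

theorem roots_ne_zero_of_natDegree {p : ℂ[X]} (hd : p.natDegree ≠ 0) : p.roots ≠ 0 := by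
  intro h
  apply hd
  rw [(IsAlgClosed.splits p).natDegree_eq_card_roots, h, Multiset.card_zero]

/-- Each root lies in the closed lower half-plane, hence is strictly closer to x-ih than to x+ih.
The two terms of the difference thus have different moduli. -/
theorem UpperStable.centralDiff {p : ℂ[X]} (hp : UpperStable p) (hd : p.natDegree ≠ 0)
    (θ : ℝ) {h : ℝ} (hh : 0 < h) : UpperStable (centralDiff θ h p) := by
  intro x hx h0
  have h1 := congrArg norm (eval_centralDiff_eq_zero h0)
  rw [norm_mul, norm_mul, norm_exp_I_mul, norm_exp_neg_I_mul, one_mul, one_mul,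
    (IsAlgClosed.splits p).eval_eq_prod_roots, (IsAlgClosed.splits p).eval_eq_prod_roots,
    norm_mul, norm_mul] at h1
  have h2 := mul_left_cancel₀ (by simpa using hp.ne_zero) h1
  refine (multiset_prod_norm_lt (roots_ne_zero_of_natDegree hd) fun z hz => ?_).ne' h2
  have := norm_sub_lt_norm_add hh (w := x - z) (by
    have := hp.im_le_zero hz
    simp; linarith)
  convert this using 2 <;> ring

/-! ### The Grace–Walsh–Szegő coincidence theorem for sums of powers -/

/-- Inversion carries the half-plane Im u ≥ y into a disc; discs, unlike half-planes, add up by the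
triangle inequality. -/
theorem norm_inv_add_le {u : ℂ} {y : ℝ} (hy : 0 < y) (hu : y ≤ u.im) :
    ‖1 / u + Complex.I / (2 * y)‖ ≤ 1 / (2 * y) := by
  have hu0 : u ≠ 0 := by rintro rfl; simp at hu; linarith
  have hy0 : (y : ℂ) ≠ 0 := by exact_mod_cast hy.ne'
  have e : 1 / u + Complex.I / (2 * y) = (2 * y + Complex.I * u) / (u * (2 * y)) := by
    field_simp
  have e2 : ‖(2 * y : ℂ)‖ = 2 * y := by
    rw [show (2 * y : ℂ) = ((2 * y : ℝ) : ℂ) by push_cast; ring, Complex.norm_real,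
      Real.norm_of_nonneg (by positivity)]
  have key : ‖2 * (y : ℂ) + Complex.I * u‖ ≤ ‖u‖ := by
    rw [← sq_le_sq₀ (norm_nonneg _) (norm_nonneg _), Complex.sq_norm, Complex.sq_norm,
      Complex.normSq_apply, Complex.normSq_apply]
    simp
    nlinarith
  rw [e, norm_div, norm_mul, e2, div_le_div_iff₀ (by positivity) (by positivity)]
  nlinarith

theorem le_im_of_norm_inv_add_le {u : ℂ} {y : ℝ} (hy : 0 < y) (hu0 : u ≠ 0)
    (h : ‖1 / u + Complex.I / (2 * y)‖ ≤ 1 / (2 * y)) : y ≤ u.im := by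
  have hy0 : (y : ℂ) ≠ 0 := by exact_mod_cast hy.ne'
  have hn : 0 < ‖u‖ := norm_pos_iff.2 hu0
  have e : 1 / u + Complex.I / (2 * y) = (2 * y + Complex.I * u) / (u * (2 * y)) := by
    field_simp
  have e2 : ‖(2 * y : ℂ)‖ = 2 * y := by
    rw [show (2 * y : ℂ) = ((2 * y : ℝ) : ℂ) by push_cast; ring, Complex.norm_real,
      Real.norm_of_nonneg (by positivity)]
  rw [e, norm_div, norm_mul, e2, div_le_div_iff₀ (by positivity) (by positivity)] at h
  have key : ‖2 * (y : ℂ) + Complex.I * u‖ ≤ ‖u‖ := by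
    nlinarith
  rw [← sq_le_sq₀ (norm_nonneg _) (norm_nonneg _), Complex.sq_norm, Complex.sq_norm,
      Complex.normSq_apply, Complex.normSq_apply] at key
  simp at key
  nlinarith

theorem norm_sum_inv_add_le {s : Multiset ℂ} {x : ℂ} (hx : 0 < x.im)
    (hs : ∀ z ∈ s, z.im ≤ 0) :
    ‖(s.map fun z ↦ 1 / (x - z)).sum + s.card * (Complex.I / (2 * x.im))‖ ≤
      s.card * (1 / (2 * x.im)) := by
  induction s using Multiset.induction with
  | empty => simp
  | cons a s ih =>
    have h1 := ih fun z hz => hs z (by simp [hz])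
    have h2 := norm_inv_add_le hx (u := x - a) (by have := hs a (by simp); simp; linarith)
    rw [Multiset.map_cons, Multiset.sum_cons, Multiset.card_cons]
    push_cast
    have h3 := norm_add_le (1 / (x - a) + Complex.I / (2 * x.im))
      ((s.map fun z ↦ 1 / (x - z)).sum + s.card * (Complex.I / (2 * x.im)))
    calc _ = _ := by congr 1; ring
      _ ≤ _ := h3
      _ ≤ _ := add_le_add h2 h1
      _ = _ := by ring

/-- Laguerre's theorem: the polar derivative of a polynomial without zeros in the upper half-plane
with respect to a point of this half-plane has no zeros there. -/
theorem UpperStable.polar_ne_zero {p : ℂ[X]} (hp : UpperStable p) {n : ℕ} (hn : n ≠ 0)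
    (hd : p.natDegree ≤ n) {ζ x : ℂ} (hζ : 0 < ζ.im) (hx : 0 < x.im) :
    n * p.eval x + (ζ - x) * p.derivative.eval x ≠ 0 := by
  intro h0
  have hn' : (n : ℂ) ≠ 0 := by exact_mod_cast hn
  have hpx := hp x hx
  have hne : x - ζ ≠ 0 := by
    intro h
    rw [← neg_sub x ζ, h] at h0
    simp [hn, hpx] at h0
  have hlog := (IsAlgClosed.splits p).eval_derivative_div_eval_of_ne_zero hpx
  -- A zero of the polar derivative means p'/p = n/(x-ζ) at x.
  have hsum : (p.roots.map fun z ↦ 1 / (x - z)).sum = n * (1 / (x - ζ)) := by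
    rw [← hlog]
    field_simp
    linear_combination -h0
  have h1 := norm_sum_inv_add_le hx (s := p.roots) fun z hz => hp.im_le_zero hz
  rw [hsum, ← (IsAlgClosed.splits p).natDegree_eq_card_roots] at h1
  -- The k missing roots count as roots at infinity: each contributes 0, a boundary point of the
  -- disc.
  obtain ⟨k, rfl⟩ := Nat.exists_eq_add_of_le hd
  set m := p.natDegree
  have hi : ‖Complex.I / (2 * (x.im : ℂ))‖ = 1 / (2 * x.im) := by
    rw [norm_div, show (2 * x.im : ℂ) = ((2 * x.im : ℝ) : ℂ) by push_cast; ring, Complex.norm_real,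
      Real.norm_of_nonneg (by positivity), Complex.norm_I]
  have h2 : ‖(k : ℂ) * (Complex.I / (2 * x.im))‖ = k * (1 / (2 * x.im)) := by
    rw [norm_mul, hi, Complex.norm_natCast]
  have h3 : ‖((m + k : ℕ) : ℂ) * (1 / (x - ζ) + Complex.I / (2 * x.im))‖ ≤
      ((m + k : ℕ) : ℝ) * (1 / (2 * x.im)) := by
    calc _ = ‖(((m + k : ℕ) : ℂ) * (1 / (x - ζ)) + m * (Complex.I / (2 * x.im))) +
            k * (Complex.I / (2 * x.im))‖ := by congr 1; push_cast; ring
      _ ≤ _ := norm_add_le _ _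
      _ ≤ _ := add_le_add h1 h2.le
      _ = _ := by push_cast; ring
  rw [norm_mul, Complex.norm_natCast] at h3
  have h4 := le_im_of_norm_inv_add_le hx hne
    (le_of_mul_le_mul_left h3 (by exact_mod_cast Nat.pos_of_ne_zero hn))
  simp at h4
  linarith

/-- Up to the factor m+1, the polar derivative replaces one factor x + c i of each power by ζ + c i.
-/
theorem sum_mul_pow_polar_ne_zero {ι : Type*} (s : Finset ι) (b c : ι → ℂ) (m : ℕ)
    (H : ∀ x : ℂ, 0 < x.im → ∑ i ∈ s, b i * (x + c i) ^ (m + 1) ≠ 0) {ζ x : ℂ} (hζ : 0 < ζ.im)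
    (hx : 0 < x.im) : ∑ i ∈ s, b i * (ζ + c i) * (x + c i) ^ m ≠ 0 := by
  set p : ℂ[X] := ∑ i ∈ s, C (b i) * (X + C (c i)) ^ (m + 1) with hp
  have hst : UpperStable p := by
    intro x hx
    simpa [hp, eval_finsetSum] using H x hx
  have hdeg : p.natDegree ≤ m + 1 := by
    refine natDegree_sum_le_of_forall_le _ _ fun i _ => (natDegree_C_mul_le _ _).trans ?_
    rw [natDegree_pow, natDegree_X_add_C, mul_one]
  have := hst.polar_ne_zero (Nat.succ_ne_zero m) hdeg hζ hx
  intro h0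
  apply this
  have e1 : p.eval x = ∑ i ∈ s, b i * (x + c i) ^ (m + 1) := by simp [hp, eval_finsetSum]
  have e2 : p.derivative.eval x = (m + 1) * ∑ i ∈ s, b i * (x + c i) ^ m := by
    simp [hp, eval_finsetSum, derivative_pow, Finset.mul_sum]
    refine Finset.sum_congr rfl fun i _ => by ring
  have e3 : (((m + 1 : ℕ)) : ℂ) * ∑ i ∈ s, b i * (ζ + c i) * (x + c i) ^ m = 0 := by
    rw [h0, mul_zero]
  rw [e1, e2, ← e3]
  simp only [Finset.mul_sum, ← Finset.sum_add_distrib]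
  refine Finset.sum_congr rfl fun i _ => ?_
  push_cast; ring

/-- The Grace–Walsh–Szegő theorem for a linear combination of powers. -/
theorem sum_mul_prod_ne_zero {ι : Type*} (s : Finset ι) (c : ι → ℂ) (Z : Multiset ℂ)
    (hZ : ∀ z ∈ Z, 0 < z.im) (b : ι → ℂ)
    (H : ∀ x : ℂ, 0 < x.im → ∑ i ∈ s, b i * (x + c i) ^ Z.card ≠ 0) :
    ∑ i ∈ s, b i * (Z.map fun z ↦ z + c i).prod ≠ 0 := by
  -- The weights must vary: each substituted point is absorbed into them.
  induction Z using Multiset.induction generalizing b with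
  | empty => simpa using H Complex.I (by simp)
  | cons a Z ih =>
    have := ih (fun z hz => hZ z (by simp [hz])) (fun i => b i * (a + c i)) fun x hx =>
      sum_mul_pow_polar_ne_zero s b c Z.card (by simpa using H) (hZ a (by simp)) hx
    simpa [mul_assoc] using this

/-! ### Mesh and shift stability -/

theorem exists_eq_C_mul_nodal {p : ℂ[X]} (hreal : ∀ z : ℂ, p.eval z = 0 → z.im = 0)
    (hnd : p.roots.Nodup) :
    ∃ s : Finset ℝ, p = C p.leadingCoeff * Lagrange.nodal s (fun y : ℝ ↦ (y : ℂ)) ∧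
      p.roots = s.val.map (fun y : ℝ ↦ (y : ℂ)) := by
  have hmem : ∀ z ∈ p.roots, ((z.re : ℝ) : ℂ) = z := fun z hz =>
    Complex.ext (by simp) (by simp [hreal z (isRoot_of_mem_roots hz)])
  have hnd' : (p.roots.map Complex.re).Nodup :=
    (Multiset.nodup_map_iff_of_inj_on fun x hx y hy hxy => by
      rw [← hmem x hx, ← hmem y hy, hxy]).2 hnd
  have hroots : p.roots = (⟨_, hnd'⟩ : Finset ℝ).val.map (fun y : ℝ ↦ (y : ℂ)) := by
    simp only [Multiset.map_map, Function.comp_def]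
    conv_lhs => rw [← Multiset.map_id p.roots]
    exact Multiset.map_congr rfl fun z hz => (hmem z hz).symm
  refine ⟨⟨_, hnd'⟩, ?_, hroots⟩
  conv_lhs => rw [(IsAlgClosed.splits p).eq_prod_roots, hroots]
  rw [Lagrange.nodal_eq, Finset.prod, Multiset.map_map]
  rfl

theorem edist_ofReal (y z : ℝ) : edist (y : ℂ) z = ENNReal.ofReal |y - z| := by
  rw [edist_dist, Complex.dist_eq, ← Complex.ofReal_sub, Complex.norm_real, Real.norm_eq_abs]

theorem le_mesh_iff {p : ℂ[X]} {s : Finset ℝ} (hs : p.roots = s.val.map (fun y : ℝ ↦ (y : ℂ)))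
    {m : ℝ≥0∞} :
    m ≤ mesh p ↔ ∀ y ∈ s, ∀ z ∈ s, y ≠ z → m ≤ ENNReal.ofReal |y - z| := by
  have hnd : p.roots.Nodup := by
    rw [hs]; exact s.nodup.map Complex.ofReal_injective
  simp only [mesh, le_iInf_iff]
  constructor
  · intro H y hy z hz hyz
    rw [← edist_ofReal]
    refine H y z ?_
    have hnd2 : ({(y : ℂ), (z : ℂ)} : Multiset ℂ).Nodup := by simpa using hyz
    rw [Multiset.le_iff_subset hnd2]
    intro w hw
    simp only [Multiset.insert_eq_cons, Multiset.mem_cons, Multiset.mem_singleton] at hw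
    rw [hs, Multiset.mem_map]
    rcases hw with rfl | rfl
    · exact ⟨y, hy, rfl⟩
    · exact ⟨z, hz, rfl⟩
  · intro H z w hzw
    have hne : z ≠ w := by
      rintro rfl
      exact Multiset.nodup_iff_le.1 hnd z hzw
    have hz : z ∈ p.roots := Multiset.mem_of_le hzw (by simp)
    have hw : w ∈ p.roots := Multiset.mem_of_le hzw (by simp)
    rw [hs, Multiset.mem_map] at hz hw
    obtain ⟨y, hy, rfl⟩ := hz
    obtain ⟨y', hy', rfl⟩ := hw
    rw [edist_ofReal]
    exact H y hy y' hy' fun h => hne (by rw [h])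

theorem nodup_roots_of_mesh_pos {p : ℂ[X]} (h : 0 < mesh p) : p.roots.Nodup := by
  rw [Multiset.nodup_iff_le]
  intro a ha
  have : mesh p ≤ edist a a := iInf_le_of_le a (iInf_le_of_le a (iInf_le_of_le ha le_rfl))
  rw [edist_self] at this
  exact absurd h (not_lt.2 this)

theorem ShiftStable.C_mul {a : ℝ} {p : ℂ[X]} (hp : ShiftStable a p) {k : ℂ} (hk : k ≠ 0) :
    ShiftStable a (C k * p) := by
  intro c hc x hx h
  refine hp c hc x hx ((mul_eq_zero.1 (?_ : k * _ = 0)).resolve_left hk)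
  rw [← h]
  simp only [eval_mul, eval_C]
  ring

/-- Partial fractions of N(x-a)/N(x), obtained by Lagrange interpolation: every residue is
nonpositive. -/
theorem shiftStable_nodal {s : Finset ℝ} {a : ℝ} (ha : 0 < a)
    (hs : ∀ y ∈ s, ∀ z ∈ s, y ≠ z → a ≤ |y - z|) :
    ShiftStable a (Lagrange.nodal s (fun y : ℝ ↦ (y : ℂ))) := by
  set v : ℝ → ℂ := fun y ↦ (y : ℂ) with hv
  set N := Lagrange.nodal s v with hN
  intro c hc x hx h0
  have hxv : ∀ i ∈ s, x ≠ v i := by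
    rintro i - rfl
    simp [hv] at hx
  have hNx : N.eval x ≠ 0 := Lagrange.eval_nodal_not_at_node hxv
  have hmon : (N.comp (X - C (a : ℂ))).Monic := Lagrange.nodal_monic.comp_X_sub_C _
  have hnat : (N.comp (X - C (a : ℂ))).natDegree = N.natDegree := by
    rw [natDegree_comp, natDegree_X_sub_C, mul_one]
  -- The leading terms cancel, so the difference equals its interpolant at the roots.
  have hdeg : (N.comp (X - C (a : ℂ)) - N).degree < s.card := by
    have e : (N.comp (X - C (a : ℂ))).degree = N.degree := by
      rw [degree_eq_natDegree hmon.ne_zero, degree_eq_natDegree Lagrange.nodal_ne_zero, hnat]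
    have := degree_sub_lt_left e hmon.ne_zero
      (by rw [hmon.leadingCoeff, Lagrange.nodal_monic.leadingCoeff])
    rwa [e, Lagrange.degree_nodal] at this
  have hint := Lagrange.eq_interpolate (v := v) (s := s) (Complex.ofReal_injective.injOn) hdeg
  have hx1 := congrArg (eval x) hint
  rw [Lagrange.eval_interpolate_not_at_node _ hxv] at hx1
  simp only [eval_sub, eval_comp, eval_X, eval_C] at hx1
  have hw : ∀ i ∈ s, Lagrange.nodalWeight s v i * (x - v i)⁻¹ *
      (N.eval (v i - a) - N.eval (v i)) =
      ((-a * ∏ j ∈ s.erase i, ((i - j)⁻¹ * (i - j - a)) : ℝ) : ℂ) * (x - v i)⁻¹ := by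
    intro i hi
    rw [hN, Lagrange.eval_nodal_at_node hi, sub_zero, Lagrange.eval_nodal,
      ← Finset.mul_prod_erase s _ hi, Lagrange.nodalWeight, Finset.prod_mul_distrib]
    push_cast
    simp only [hv, sub_right_comm (i : ℂ) (a : ℂ)]
    ring
  rw [Finset.sum_congr rfl hw] at hx1
  have hc' : c = 1 + ∑ i ∈ s, ((-a * ∏ j ∈ s.erase i, ((i - j)⁻¹ * (i - j - a)) : ℝ) : ℂ) *
      (x - v i)⁻¹ := by
    apply mul_right_cancel₀ hNx
    linear_combination hx1 - h0
  rw [hc', Complex.add_im, Complex.one_im, zero_add, Complex.im_sum] at hc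
  refine not_le.2 hc (Finset.sum_nonneg fun i hi => ?_)
  rw [Complex.im_ofReal_mul, Complex.inv_im]
  have hB : 0 ≤ ∏ j ∈ s.erase i, ((i - j)⁻¹ * (i - j - a)) := by
    refine Finset.prod_nonneg fun j hj => ?_
    have hji := Finset.ne_of_mem_erase hj
    have := hs i hi j (Finset.mem_of_mem_erase hj) hji.symm
    rcases lt_or_gt_of_ne hji with h | h
    · rw [abs_of_pos (by linarith)] at this
      exact mul_nonneg (inv_nonneg.2 (by linarith)) (by linarith)
    · exact mul_nonneg_of_nonpos_of_nonpos (inv_nonpos.2 (by linarith)) (by linarith)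
  have : -(x - v i).im / Complex.normSq (x - v i) ≤ 0 :=
    div_nonpos_of_nonpos_of_nonneg (by simp [hv]; linarith) (Complex.normSq_nonneg _)
  nlinarith [mul_nonneg ha.le hB, mul_nonneg (mul_nonneg ha.le hB) (neg_nonneg.2 this)]

/-- The residue at y is -a times this product. Were it positive, the ratio at y + iε would behave
like residue/(iε) and enter the lower half-plane for small ε > 0. -/
theorem ShiftStable.prod_nonneg {s : Finset ℝ} {a : ℝ} (ha : 0 < a)
    (h : ShiftStable a (Lagrange.nodal s (fun y : ℝ ↦ (y : ℂ)))) {y : ℝ} (hy : y ∈ s) :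
    0 ≤ ∏ j ∈ s.erase y, ((y - j)⁻¹ * (y - j - a)) := by
  by_contra! hB
  set R : ℂ → ℂ := fun z ↦ ∏ j ∈ s.erase y, (z - j) with hR
  have hRc : Continuous R := by fun_prop
  have hRy : R y ≠ 0 := Finset.prod_ne_zero_iff.2 fun j hj => by
    rw [sub_ne_zero]
    exact_mod_cast (Finset.ne_of_mem_erase hj).symm
  set u : ℝ → ℂ := fun ε ↦ (y : ℂ) + Complex.I * ε with hu
  have hu0 : u 0 = y := by simp [hu]
  have huc : Continuous u := by fun_prop
  have hcont : ContinuousAt (fun ε : ℝ ↦ ((Complex.I * ε - a) * R (u ε - a) / R (u ε)).re) 0 := by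
    refine Complex.continuous_re.continuousAt.comp (ContinuousAt.div ?_ ?_ ?_)
    · fun_prop
    · fun_prop
    · rwa [hu0]
  have hval : 0 < ((Complex.I * ((0 : ℝ) : ℂ) - a) * R (u 0 - a) / R (u 0)).re := by
    have e : (Complex.I * ((0 : ℝ) : ℂ) - a) * R (u 0 - a) / R (u 0) =
        ((-a * ∏ j ∈ s.erase y, ((y - j)⁻¹ * (y - j - a)) : ℝ) : ℂ) := by
      rw [hu0]
      simp only [hR, Finset.prod_mul_distrib, Finset.prod_inv_distrib]
      push_cast
      have : ∀ j : ℝ, (y : ℂ) - a - j = y - j - a := fun j => by ring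
      simp only [this]
      ring
    rw [e, Complex.ofReal_re]
    nlinarith
  have hev := (hcont.eventually (lt_mem_nhds hval)).filter_mono
    (nhdsWithin_le_nhds (s := Set.Ioi 0))
  obtain ⟨ε, hε, hε0⟩ := (hev.and self_mem_nhdsWithin).exists
  have hε0 : 0 < ε := hε0
  set w := (Complex.I * ε - a) * R (u ε - a) / R (u ε) with hw
  have hεc : (ε : ℂ) ≠ 0 := by exact_mod_cast hε0.ne'
  have him : 0 < (u ε).im := by simpa [hu] using hε0
  have hRu : R (u ε) ≠ 0 := Finset.prod_ne_zero_iff.2 fun j hj => by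
    intro h
    have := congrArg Complex.im h
    simp [hu] at this
    linarith
  have hc : (w / (Complex.I * ε)).im < 0 := by
    have : w / (Complex.I * ε) = -(Complex.I * w) * ((ε⁻¹ : ℝ) : ℂ) := by
      push_cast
      field_simp
      linear_combination w * Complex.I_sq
    rw [this, Complex.im_mul_ofReal]
    have : 0 < ε⁻¹ := by positivity
    simp only [Complex.neg_im, Complex.I_mul_im]
    nlinarith
  refine h _ hc (u ε) him ?_
  rw [Lagrange.eval_nodal, Lagrange.eval_nodal, ← Finset.mul_prod_erase s _ hy,
    ← Finset.mul_prod_erase s _ hy]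
  change (u ε - a - y) * R (u ε - a) - w / (Complex.I * ε) * ((u ε - y) * R (u ε)) = 0
  rw [hw]
  simp only [hu] at hRu ⊢
  field_simp
  ring

theorem le_mesh_of_shiftStable {p : ℂ[X]} {s : Finset ℝ} (hp : p ≠ 0)
    (hps : p = C p.leadingCoeff * Lagrange.nodal s (fun y : ℝ ↦ (y : ℂ)))
    (hs : p.roots = s.val.map (fun y : ℝ ↦ (y : ℂ))) {m : ℝ≥0∞}
    (H : ∀ a : ℝ, 0 < a → ENNReal.ofReal a ≤ m → ShiftStable a p) : m ≤ mesh p := by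
  rw [le_mesh_iff hs]
  suffices ∀ y ∈ s, ∀ z ∈ s, z < y → m ≤ ENNReal.ofReal (y - z) by
    intro y hy z hz hyz
    rcases lt_or_gt_of_ne hyz with h | h
    · rw [abs_sub_comm, abs_of_pos (by linarith)]
      exact this z hz y hy h
    · rw [abs_of_pos (by linarith)]
      exact this y hy z hz h
  intro y hy z hz hzy
  by_contra! hlt
  -- t is the root immediately below y.
  obtain ⟨t, ht, htmax⟩ := (s.filter (· < y)).exists_max_image id ⟨z, by simp [hz, hzy]⟩
  simp only [Finset.mem_filter, id] at ht htmax
  have hlt' : ENNReal.ofReal (y - t) < m :=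
    (ENNReal.ofReal_le_ofReal (by linarith [htmax z ⟨hz, hzy⟩])).trans_lt hlt
  -- Taking a just above y - t makes the factor of t the only negative one; a larger a could give an
  -- even number of negative factors and no contradiction.
  have h1 : ∀ᶠ a in nhdsWithin (y - t) (Set.Ioi (y - t)), ∀ j ∈ s, j < t → a < y - j := by
    rw [Finset.eventually_all]
    intro j hj
    by_cases hjt : j < t
    · filter_upwards [nhdsWithin_le_nhds (gt_mem_nhds (show y - t < y - j by linarith))] with a ha _
      exact ha
    · simp [hjt]
  have h2 : ∀ᶠ a in nhdsWithin (y - t) (Set.Ioi (y - t)), ENNReal.ofReal a < m :=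
    nhdsWithin_le_nhds (ENNReal.continuous_ofReal.continuousAt.eventually (gt_mem_nhds hlt'))
  obtain ⟨a, ⟨ha1, ha2⟩, ha3⟩ := ((h1.and h2).and self_mem_nhdsWithin).exists
  have ha3 : y - t < a := ha3
  have ha : 0 < a := by linarith [ht.2]
  have hst : ShiftStable a (Lagrange.nodal s (fun y : ℝ ↦ (y : ℂ))) := by
    have hk : p.leadingCoeff ≠ 0 := by simpa using hp
    have h3 := (H a ha ha2.le).C_mul (inv_ne_zero hk)
    rw [hps] at h3
    rwa [leadingCoeff_mul, leadingCoeff_C, Lagrange.nodal_monic.leadingCoeff, mul_one,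
      ← mul_assoc, ← C_mul, inv_mul_cancel₀ hk, C_1, one_mul] at h3
  have hB := hst.prod_nonneg ha hy
  rw [← Finset.mul_prod_erase _ _ (Finset.mem_erase.2 ⟨ht.2.ne, ht.1⟩)] at hB
  refine not_lt.2 hB (mul_neg_of_neg_of_pos ?_ (Finset.prod_pos fun j hj => ?_))
  · exact mul_neg_of_pos_of_neg (inv_pos.2 (by linarith [ht.2])) (by linarith)
  · simp only [Finset.mem_erase] at hj
    rcases lt_or_gt_of_ne hj.2.1 with h | h
    · have hjt := lt_of_le_of_ne (htmax j ⟨hj.2.2, h⟩) hj.1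
      have := ha1 j hj.2.2 hjt
      exact mul_pos (inv_pos.2 (by linarith)) (by linarith)
    · exact mul_pos_of_neg_of_neg (inv_lt_zero.2 (by linarith)) (by linarith)

theorem shiftStable_of_le_mesh {p : ℂ[X]} (hp : p ≠ 0)
    (hreal : ∀ z : ℂ, p.eval z = 0 → z.im = 0) {a : ℝ} (ha : 0 < a)
    (h : ENNReal.ofReal a ≤ mesh p) : ShiftStable a p := by
  obtain ⟨s, hps, hs⟩ := exists_eq_C_mul_nodal hreal
    (nodup_roots_of_mesh_pos ((ENNReal.ofReal_pos.2 ha).trans_le h))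
  rw [hps]
  refine ShiftStable.C_mul (shiftStable_nodal ha fun y hy z hz hyz => ?_) (by simpa using hp)
  exact (ENNReal.ofReal_le_ofReal_iff (abs_nonneg _)).1 ((le_mesh_iff hs).1 h y hy z hz hyz)

/-! ### Hyperbolicity and simple roots of the central difference -/

theorem IsHyperbolic.upperStable {p : ℂ[X]} (hp : IsHyperbolic p) : UpperStable p :=
  fun x hx h => hx.ne' (hp.2 x h)

theorem map_conj_eq_iff {p : ℂ[X]} :
    p.map (starRingEnd ℂ) = p ↔ ∀ k, (p.coeff k).im = 0 := by
  simp [Polynomial.ext_iff, Complex.conj_eq_iff_im]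

theorem map_conj_centralDiff {p : ℂ[X]} (hp : p.map (starRingEnd ℂ) = p) (θ h : ℝ) :
    (centralDiff θ h p).map (starRingEnd ℂ) = centralDiff θ h p := by
  simp only [centralDiff, Polynomial.map_mul, Polynomial.map_sub, Polynomial.map_comp, hp,
    Polynomial.map_add, map_X, map_C, ← Complex.exp_conj, map_div₀, map_one, map_mul, map_neg,
    Complex.conj_I, Complex.conj_ofReal, map_ofNat]
  have e : C (1 / (2 * -Complex.I)) = -C (1 / (2 * Complex.I)) := by
    rw [← C_neg, mul_neg, div_neg]
  simp only [neg_mul, mul_neg, neg_neg, sub_neg_eq_add, ← sub_eq_add_neg] at e ⊢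
  rw [e]
  ring

theorem IsHyperbolic.centralDiff {p : ℂ[X]} (hp : IsHyperbolic p) (hd : p.natDegree ≠ 0)
    (θ : ℝ) {h : ℝ} (hh : 0 < h) : IsHyperbolic (_root_.centralDiff θ h p) := by
  have hmap := map_conj_centralDiff (map_conj_eq_iff.2 hp.1) θ h
  have hst := hp.upperStable.centralDiff hd θ hh
  refine ⟨map_conj_eq_iff.1 hmap, fun z hz => ?_⟩
  -- Real coefficients reflect a zero in the lower half-plane into the upper one.
  rcases lt_trichotomy z.im 0 with h1 | h1 | h1
  · have := hst ((starRingEnd ℂ) z) (by simpa using h1)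
    rw [← hmap, eval_map, eval₂_hom, hz, map_zero] at this
    exact absurd rfl this
  · exact h1
  · exact absurd hz (hst z h1)

theorem im_sum_inv_neg {s : Multiset ℂ} (hs : s ≠ 0) {x : ℂ} (h : ∀ z ∈ s, z.im < x.im) :
    ((s.map fun z ↦ 1 / (x - z)).sum).im < 0 := by
  induction s using Multiset.induction with
  | empty => exact absurd rfl hs
  | cons a s ih =>
    have ha : (1 / (x - a)).im < 0 := by
      have h1 := h a (by simp)
      have h2 : x - a ≠ 0 := fun h => by
        have := congrArg Complex.im h
        simp at this; linarith
      rw [one_div, Complex.inv_im]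
      exact div_neg_of_neg_of_pos (by simp; linarith) (Complex.normSq_pos.2 h2)
    rw [Multiset.map_cons, Multiset.sum_cons, Complex.add_im]
    by_cases h0 : s = 0
    · simpa [h0] using ha
    · have := ih h0 fun z hz => h z (by simp [hz])
      linarith

theorem im_sum_inv_pos {s : Multiset ℂ} (hs : s ≠ 0) {x : ℂ} (h : ∀ z ∈ s, x.im < z.im) :
    0 < ((s.map fun z ↦ 1 / (x - z)).sum).im := by
  have := im_sum_inv_neg (s := s.map Neg.neg) (x := -x) (by simpa using hs) (by simpa using h)
  simp only [Multiset.map_map, Function.comp_def] at this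
  have e : ∀ z : ℂ, 1 / (-x - -z) = -(1 / (x - z)) := fun z => by
    rw [← div_neg]; congr 1; ring
  simp only [e, Multiset.sum_map_neg (f := fun z ↦ 1 / (x - z)), Complex.neg_im] at this
  linarith

theorem derivative_centralDiff (θ h : ℝ) (p : ℂ[X]) :
    (centralDiff θ h p).derivative = centralDiff θ h p.derivative := by
  simp [centralDiff, derivative_comp]

/-- At a multiple root z, which is real, p'/p would agree at z+ih and z-ih, where its imaginary
parts have opposite signs. -/
theorem IsHyperbolic.nodup_roots_centralDiff {p : ℂ[X]} (hp : IsHyperbolic p)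
    (hd : p.natDegree ≠ 0) (θ : ℝ) {h : ℝ} (hh : 0 < h) : (_root_.centralDiff θ h p).roots.Nodup := by
  classical
  have hD := hp.centralDiff hd θ hh
  have hD0 := hD.upperStable.ne_zero
  rw [Multiset.nodup_iff_count_le_one]
  intro z
  rw [count_roots]
  by_contra! hlt
  obtain ⟨h1, h2⟩ := (one_lt_rootMultiplicity_iff_isRoot hD0).1 hlt
  have hz := hD.2 z h1
  rw [derivative_centralDiff] at h2
  have e1 := eval_centralDiff_eq_zero h1
  have e2 := eval_centralDiff_eq_zero h2
  have hR : ∀ w ∈ p.roots, w.im = 0 := fun w hw => hp.2 w (isRoot_of_mem_roots hw)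
  have n1 : p.eval (z + Complex.I * h) ≠ 0 := fun h0 => by
    have := hp.2 _ h0
    simp [hz] at this; linarith
  have n2 : p.eval (z - Complex.I * h) ≠ 0 := fun h0 => by
    have := hp.2 _ h0
    simp [hz] at this; linarith
  have l1 := (IsAlgClosed.splits p).eval_derivative_div_eval_of_ne_zero n1
  have l2 := (IsAlgClosed.splits p).eval_derivative_div_eval_of_ne_zero n2
  have hr0 := roots_ne_zero_of_natDegree hd
  have s1 := im_sum_inv_neg hr0 (x := z + Complex.I * h) fun w hw => by
    simpa [hz, hR w hw] using hh
  have s2 := im_sum_inv_pos hr0 (x := z - Complex.I * h) fun w hw => by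
    simpa [hz, hR w hw] using hh
  rw [← l1] at s1
  rw [← l2] at s2
  have : p.derivative.eval (z + Complex.I * h) / p.eval (z + Complex.I * h) =
      p.derivative.eval (z - Complex.I * h) / p.eval (z - Complex.I * h) := by
    rw [← mul_div_mul_left _ _ (Complex.exp_ne_zero (Complex.I * θ)), e1, e2,
      mul_div_mul_left _ _ (Complex.exp_ne_zero _)]
  rw [this] at s1
  linarith

/-! ### Shift stability of the central difference -/

theorem ShiftStable.centralDiff {p : ℂ[X]} {a : ℝ} (hp : ShiftStable a p) (hd : p.natDegree ≠ 0)
    (θ : ℝ) {h : ℝ} (hh : 0 < h) : ShiftStable a (_root_.centralDiff θ h p) := by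
  intro c hc
  set r : ℂ[X] := p.comp (X - C (a : ℂ)) - C c * p with hr
  have hst : UpperStable r := fun x hx => by simpa [hr] using hp c hc x hx
  -- The top coefficient is multiplied by 1-c, nonzero since c is not real.
  have hrd : r.natDegree ≠ 0 := by
    have hp0 : p ≠ 0 := by rintro rfl; simp at hd
    have hc1 : (1 : ℂ) - c ≠ 0 := fun h => by
      have := congrArg Complex.im h
      simp at this; linarith
    have hn : (p.comp (X - C (a : ℂ))).natDegree = p.natDegree := by
      rw [natDegree_comp, natDegree_X_sub_C, mul_one]
    have hl : (p.comp (X - C (a : ℂ))).leadingCoeff = p.leadingCoeff := by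
      rw [leadingCoeff_comp (by simp), leadingCoeff_X_sub_C, one_pow, mul_one]
    have hcoeff : r.coeff p.natDegree = (1 - c) * p.leadingCoeff := by
      rw [hr, coeff_sub, coeff_C_mul]
      conv_lhs => rw [← hn]
      rw [coeff_natDegree, hl, hn, coeff_natDegree]
      ring
    have : p.natDegree ≤ r.natDegree := le_natDegree_of_ne_zero (by
      rw [hcoeff]; exact mul_ne_zero hc1 (by simpa using hp0))
    omega
  intro x hx h0
  refine hst.centralDiff hrd θ hh x hx ?_
  rw [← h0]
  simp only [eval_centralDiff, hr, eval_sub, eval_mul, eval_comp, eval_X, eval_C]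
  rw [show x + Complex.I * h - a = x - a + Complex.I * h by ring,
    show x - Complex.I * h - a = x - a - Complex.I * h by ring]
  ring

theorem ShiftStable.centralDiff_of_X_pow {p : ℂ[X]} (hp : IsHyperbolic p) {θ h a : ℝ}
    (hX : ShiftStable a (_root_.centralDiff θ h (X ^ p.natDegree))) :
    ShiftStable a (_root_.centralDiff θ h p) := by
  intro c hc x hx
  have hlc : p.leadingCoeff ≠ 0 := by simpa using hp.upperStable.ne_zero
  set e₁ := Complex.exp (Complex.I * θ)
  set e₂ := Complex.exp (-(Complex.I * θ))
  set κ : ℂ := 1 / (2 * Complex.I)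
  have heval : ∀ y : ℂ, p.eval (x + y) =
      p.leadingCoeff * ((p.roots.map fun z ↦ x - z).map fun z ↦ z + y).prod := fun y => by
    rw [(IsAlgClosed.splits p).eval_eq_prod_roots, Multiset.map_map]
    congr 3
    ext z
    simp only [Function.comp]
    ring
  -- The four terms of Δp(x-a) - cΔp(x) are products of shifted copies of the x-z, z a root of p.
  -- Equating all x-z to one point y gives the expression for x^n.
  have := sum_mul_prod_ne_zero (Finset.univ : Finset (Fin 4))
    ![-a + Complex.I * h, -a - Complex.I * h, Complex.I * h, -(Complex.I * h)]
    (p.roots.map fun z ↦ x - z)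
    (by
      intro z hz
      obtain ⟨w, hw, rfl⟩ := Multiset.mem_map.1 hz
      simpa [hp.2 w (isRoot_of_mem_roots hw)] using hx)
    ![κ * e₁, -(κ * e₂), -(c * κ * e₁), c * κ * e₂]
    (by
      intro y hy h0
      refine hX c hc y hy ?_
      rw [← h0, Multiset.card_map, ← (IsAlgClosed.splits p).natDegree_eq_card_roots]
      simp only [eval_centralDiff, eval_pow, eval_X, Fin.sum_univ_four, Matrix.cons_val]
      ring)
  intro h0
  refine mul_ne_zero hlc this ?_
  rw [← h0]
  simp only [eval_centralDiff, Fin.sum_univ_four, Matrix.cons_val]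
  rw [show x - a + Complex.I * h = x + (-a + Complex.I * h) by ring,
    show x - a - Complex.I * h = x + (-a - Complex.I * h) by ring,
    show x - Complex.I * h = x + -(Complex.I * h) by ring]
  simp only [heval]
  ring

theorem isHyperbolic_X_pow (n : ℕ) : IsHyperbolic (X ^ n : ℂ[X]) := by
  refine ⟨fun k => ?_, fun z hz => ?_⟩
  · rw [coeff_X_pow]
    split_ifs <;> simp
  · rw [eval_pow, eval_X] at hz
    simp [eq_zero_of_pow_eq_zero hz]

theorem IsHyperbolic.max_mesh_le {p : ℂ[X]} (hp : IsHyperbolic p) (hd : p.natDegree ≠ 0)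
    (θ : ℝ) {h : ℝ} (hh : 0 < h) :
    max (mesh p) (mesh (_root_.centralDiff θ h (X ^ p.natDegree))) ≤
      mesh (_root_.centralDiff θ h p) := by
  have hD := hp.centralDiff hd θ hh
  have hX := (isHyperbolic_X_pow p.natDegree).centralDiff (by simpa using hd) θ hh
  obtain ⟨s, hps, hs⟩ := exists_eq_C_mul_nodal hD.2 (hp.nodup_roots_centralDiff hd θ hh)
  refine max_le ?_ ?_ <;>
    refine le_mesh_of_shiftStable hD.upperStable.ne_zero hps hs fun a ha hle => ?_
  · exact (shiftStable_of_le_mesh hp.upperStable.ne_zero hp.2 ha hle).centralDiff hd θ hh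
  · exact (shiftStable_of_le_mesh hX.upperStable.ne_zero hX.2 ha hle).centralDiff_of_X_pow hp

theorem theorem1p7 (n : ℕ) (θ h : ℝ) (hh : 0 < h)
    (hθ : (θ ∈ Set.Ioo 0 Real.pi ∧ 2 ≤ n) ∨ (θ = 0 ∧ 3 ≤ n)) :
    (∀ p : ℂ[X], IsHyperbolic p → p.natDegree = n →
      IsHyperbolic (centralDiff θ h p) ∧
      max (mesh p) (mesh (centralDiff θ h (X ^ n))) ≤ mesh (centralDiff θ h p) ∧
      mesh (centralDiff θ h (X ^ n)) ≤ max (mesh p) (mesh (centralDiff θ h (X ^ n)))) ∧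
    IsLeast {m : ℝ≥0∞ | ∃ p : ℂ[X], IsHyperbolic p ∧ p.natDegree = n ∧
      m = mesh (centralDiff θ h p)} (mesh (centralDiff θ h (X ^ n))) := by
  have hn : n ≠ 0 := by omega
  refine ⟨?_, ⟨X ^ n, isHyperbolic_X_pow n, natDegree_X_pow n, rfl⟩, ?_⟩
  · rintro p hp rfl
    exact ⟨hp.centralDiff hn θ hh, hp.max_mesh_le hn θ hh, le_max_right _ _⟩
  · rintro m ⟨p, hp, rfl, rfl⟩
    exact (le_max_right _ _).trans (hp.max_mesh_le hn θ hh)
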